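/- A simple graph is called an optimal simple quintic graph on $2n$ vertices if it is $5$-regular, has $2n$ vertices, every edge lies in a triangle, and it has exactly $2n$ triangles. Let $H$ be a $4$-regular loopless multigraph on $n$ vertices. An even cycle decomposition of $H$ is a list of cyclic sequences of vertices and edges (closed trails of positive even length, which may revisit vertices) that together use every edge of $H$ exactly once. Call it balanced if each vertex of $H$ occurs exactly once in an odd position and exactly once in an even position of the listed cycles. For a balanced decomposition, the diamond replacement is formed by replacing each vertex $x$ of $H$ by a diamond ($K_4$ minus an edge), whose two degree-$2$ vertices are attached to the two edges before and after the odd occurrence of $x$ and whose two degree-$3$ vertices are attached to the two edges before and after the even occurrence of $x$; for every edge of $H$ the two diamond vertices attached to it (a degree-$2$ vertex of one diamond and a degree-$3$ vertex of another) are identified. We say that $[x,y]$ appears if $x,y$ are cyclically consecutive vertices in this order in a listed cycle; two appearances of pairs are consecutive if one directly follows the other in a cycle. Consider the rules (i) for any vertices $x,y$, at most one of $[x,y]$ and $[y,x]$ appears, and at most once; (ii) for any vertices $x,y,z$, there are no appearances of three pairs, one of $[x,y]$ or $[y,x]$, one of $[y,z]$ or $[z,y]$, and one of $[z,x]$ or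 $[x,z]$, such that no two of the three appearances are consecutive. Then, for every $n$: every optimal simple quintic graph on $2n$ vertices is isomorphic to the diamond replacement of a balanced even cycle decomposition, satisfying (i) and (ii), of a $4$-regular graph on $n$ vertices; and (i) and (ii) are the only restrictions: for every balanced even cycle decomposition of a $4$-regular loopless multigraph on $n$ vertices, its diamond replacement (as a graph with any parallel edges merged) is an optimal simple quintic graph on $2n$ vertices if and only if (i) and (ii) hold. -/

import Mathlib

open scoped Graph

/-- `G` is an optimal simple quintic graph on `2n` vertices: it is simple, `5`-regular, has exactly
`2n` vertices, every edge lies in a triangle, and there are exactly `2n` triangles. -/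
structure IsOptimalQuintic {W : Type*} (G : SimpleGraph W) (n : ℕ) : Prop where
  finite : Finite W
  card_eq : Nat.card W = 2 * n
  regular : ∀ v, (G.neighborSet v).ncard = 5
  triangle_property : ∀ u v, G.Adj u v → ∃ w, G.Adj u w ∧ G.Adj v w
  card_triangles : (G.cliqueSet 3).ncard = 2 * n

/-- `H` is a `4`-regular graph on `n` vertices; parallel edges are allowed, loops are not. -/
structure IsQuartic {α β : Type*} (H : Graph α β) (n : ℕ) : Prop where
  loopless : H.Loopless
  card_eq : V(H).encard = n
  regular : ∀ x ∈ V(H), (H.incidenceSet x).ncard = 4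

/-- An even cycle decomposition of `H`: a list of cyclic sequences (closed trails, which may
revisit vertices) of positive even length that together traverse every edge exactly once. In the
`c`-th cycle the edge `edge c i` goes from the vertex `vert c i` to the cyclically next vertex
`vert c (i + 1)`. -/
structure EvenCycleDecomposition {α β : Type*} (H : Graph α β) where
  numCycles : ℕ
  halfLength : Fin numCycles → ℕ
  halfLength_pos : ∀ c, 0 < halfLength c
  vert : ∀ c, Fin (2 * halfLength c) → α
  edge : ∀ c, Fin (2 * halfLength c) → β
  isLink : ∀ c i, H.IsLink (edge c i) (vert c i) (vert c (finRotate _ i))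
  edge_unique : ∀ e ∈ E(H), ∃! p : (Σ c, Fin (2 * halfLength c)), edge p.1 p.2 = e

namespace EvenCycleDecomposition

variable {α β : Type*} {H : Graph α β} (C : EvenCycleDecomposition H)

/-- The positions in the listed cycles. -/
abbrev Pos : Type := Σ c, Fin (2 * C.halfLength c)

/-- The cyclically next position in the same cycle. -/
def next : Equiv.Perm C.Pos := Equiv.sigmaCongrRight fun c => finRotate (2 * C.halfLength c)

/-- The vertex at a position. -/
def vertAt (p : C.Pos) : α := C.vert p.1 p.2

/-- The edge traversed between a position and the next one. -/
def edgeAt (p : C.Pos) : β := C.edge p.1 p.2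

/-- The first, third, fifth, ... positions of each cycle. -/
def IsOddPos (p : C.Pos) : Prop := Even (p.2 : ℕ)

/-- The second, fourth, sixth, ... positions of each cycle. -/
def IsEvenPos (p : C.Pos) : Prop := Odd (p.2 : ℕ)

/-- Each vertex occurs exactly once in an odd position and exactly once in an even position. -/
def IsBalanced : Prop :=
  ∀ x ∈ V(H), (∃! p, C.IsOddPos p ∧ C.vertAt p = x) ∧ (∃! p, C.IsEvenPos p ∧ C.vertAt p = x)

/-- The consecutive pair `[x, y]` appears at position `p`. -/
def AppearsAt (x y : α) (p : C.Pos) : Prop := C.vertAt p = x ∧ C.vertAt (C.next p) = y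

/-- One of `[x, y]` and `[y, x]` appears at position `p`. -/
def PairAt (x y : α) (p : C.Pos) : Prop := C.AppearsAt x y p ∨ C.AppearsAt y x p

/-- The pairs at the positions `p` and `q` follow each other in a cycle. -/
def Consecutive (p q : C.Pos) : Prop := C.next p = q ∨ C.next q = p

/-- At most one of `[x, y]` and `[y, x]` appears, and at most once. -/
def PairsUnique : Prop := ∀ x y : α, {p | C.PairAt x y p}.Subsingleton

/-- The pairs `[x, y]`, `[y, z]`, `[z, x]` (each in either direction) do not all appear, unless two
of them appear consecutively. -/
def NoSpreadTriangle : Prop :=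
  ∀ (x y z : α) (p q r : C.Pos), C.PairAt x y p → C.PairAt y z q → C.PairAt z x r →
    C.Consecutive p q ∨ C.Consecutive q r ∨ C.Consecutive r p

/-- The diamond `K₄` minus an edge: the two vertices `(true, _)` have degree `3` and the two
vertices `(false, _)` have degree `2`. -/
def diamond : SimpleGraph (Bool × Bool) where
  Adj a b := a ≠ b ∧ (a.1 = true ∨ b.1 = true)
  symm := ⟨fun _ _ h => ⟨h.1.symm, h.2.symm⟩⟩
  loopless := ⟨fun _ h => h.1 rfl⟩

/-- Where the four vertices of the diamond replacing the vertex `x` of `H` are glued. Each edge of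
`H` becomes one vertex of the new graph. The two degree `2` vertices of the diamond of `x` are
placed on the two edges before and after the odd occurrence of `x`, and the two degree `3` vertices
on the two edges before and after its even occurrence. Thus along every edge of `H` a degree `2`
vertex of one diamond is identified with a degree `3` vertex of another. -/
def Placed (x : α) : Bool × Bool → β → Prop
  | (false, false), e => ∃ p, C.IsOddPos (C.next p) ∧ C.vertAt (C.next p) = x ∧ C.edgeAt p = e
  | (false, true), e => ∃ p, C.IsOddPos p ∧ C.vertAt p = x ∧ C.edgeAt p = e
  | (true, false), e => ∃ p, C.IsEvenPos (C.next p) ∧ C.vertAt (C.next p) = x ∧ C.edgeAt p = e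
  | (true, true), e => ∃ p, C.IsEvenPos p ∧ C.vertAt p = x ∧ C.edgeAt p = e

/-- The graph formed from the decomposition by replacing every vertex of `H` by a diamond: the union
of all the diamonds, glued as described by `Placed`. -/
def diamondReplacement : SimpleGraph E(H) where
  Adj e f := e ≠ f ∧ ∃ x ∈ V(H), ∃ a b, diamond.Adj a b ∧ C.Placed x a e ∧ C.Placed x b f
  symm := ⟨fun _ _ h => by
    obtain ⟨hne, x, hx, a, b, hab, ha, hb⟩ := h
    exact ⟨hne.symm, x, hx, b, a, hab.symm, hb, ha⟩⟩
  loopless := ⟨fun _ h => h.1 rfl⟩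

end EvenCycleDecomposition

/-!
Everything is read off from two maps. In a balanced decomposition every edge `p` of `H`, i.e. every
vertex of the new graph, lies in exactly two diamonds: as a degree `2` vertex in the diamond of
`tip p`, the end of `p` at an odd position, and as a degree `3` vertex in the diamond of `hub p`,
the end at an even position. Both maps are two-to-one and they never agree, and `p ≠ q` are adjacent
in the diamond replacement iff `hub p = hub q`, `hub p = tip q` or `tip p = hub q`. Such a pair of
maps is a `DiamondGluing`.

Restrictions (`DiamondGluing.isOptimalQuintic_graph_iff`). The neighbors of `p` form sets of sizes
`1`, `2`, `2`, so the degree is `5` unless some `q` is antiparallel to `p`: `hub p = tip q` and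
`hub q = tip p`. Without antiparallel pairs, `p ↦ {p} ∪ hub⁻¹ {tip p}` is an injection of the `2n`
vertices into the triangles, so there are exactly `2n` triangles iff every triangle has this form.
The other triangles come from `p ≠ q` with the same tip and the same hub (excluded by (i)) or from
three vertices with `hub p = tip q`, `hub q = tip r`, `hub r = tip p`. The latter are the
configurations excluded by (ii): two pairs that meet in a diamond are consecutive iff their tips or
their hubs agree, so three pairwise nonconsecutive pairs are cyclically oriented.

Structure (`IsOptimalQuintic.exists_diamondGluing`). In an optimal graph each vertex lies in at
least `3` triangles, because these must cover `5` neighbors, and by double counting in exactly `3`.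
Hence each `v` has one partner `σ v` with which it shares two triangles, and it shares one triangle
with each other neighbor. The partner edges form a perfect matching, and counting again shows that
every triangle contains exactly one of them. So `v` lies in exactly one triangle without `σ v`; with
`hub v` the matching edge at `v` and `tip v` the matching edge in that triangle, `G` is the graph of
a gluing.

Realization (`DiamondGluing.exists_graph_iso_diamondReplacement`). For a gluing, `tip` and `hub`
each pair up the vertices; the two fixed-point-free involutions alternate along even cycles
(`exists_set_alternating`, `exists_cycles_of_alternating`), and these are the cycles of the wanted
decomposition of the multigraph in which `p` joins `tip p` to `hub p`.
-/

/-! ### Two-to-one maps and isomorphism invariance -/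

theorem two_fiber_iff {P Q : Type*} {f : P → Q} {x : Q} (h : (f ⁻¹' {x}).ncard = 2) :
    ∃ u v, u ≠ v ∧ ∀ w, f w = x ↔ w = u ∨ w = v := by
  obtain ⟨u, v, huv, h⟩ := Set.ncard_eq_two.1 h
  exact ⟨u, v, huv, fun w => by simpa using Set.ext_iff.1 h w⟩

theorem card_eq_two_mul_of_two_fibers {P Q : Type*} [Finite P] [Finite Q] {f : P → Q}
    (h : ∀ x, (f ⁻¹' {x}).ncard = 2) : Nat.card P = 2 * Nat.card Q := by
  have e : Nat.card P = Nat.card (Σ x, f ⁻¹' {x}) :=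
    Nat.card_congr (Equiv.sigmaFiberEquiv f).symm
  have := Fintype.ofFinite Q
  rw [e, Nat.card_sigma]
  simp only [Nat.card_coe_set_eq, h]
  simp [mul_comm]

theorem IsOptimalQuintic.of_iso {V W : Type*} {G : SimpleGraph V} {G' : SimpleGraph W} {n : ℕ}
    (h : IsOptimalQuintic G n) (e : G ≃g G') : IsOptimalQuintic G' n where
  finite := have := h.finite; Finite.of_equiv _ e.toEquiv
  card_eq := by rw [← h.card_eq, Nat.card_congr e.toEquiv]
  regular v := by
    rw [← h.regular (e.symm v), ← Nat.card_coe_set_eq, ← Nat.card_coe_set_eq]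
    exact (Nat.card_congr (e.symm.mapNeighborSet v))
  triangle_property u v huv := by
    obtain ⟨w, h1, h2⟩ := h.triangle_property _ _ (e.symm.map_adj_iff.2 huv)
    exact ⟨e w, by simpa using e.map_adj_iff.2 h1, by simpa using e.map_adj_iff.2 h2⟩
  card_triangles := by
    rw [← h.card_triangles]
    refine (Set.ncard_congr (fun s _ => s.map e.toEquiv.toEmbedding) ?_ ?_ ?_).symm
    · intro s hs
      have := hs.map (f := e.toEquiv.toEmbedding)
      refine SimpleGraph.IsNClique.mono ?_ this
      rw [SimpleGraph.map_le_iff_le_comap]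
      intro a b hab
      exact e.map_adj_iff.2 hab
    · intro s t _ _ hst
      exact Finset.map_injective _ hst
    · intro t ht
      refine ⟨t.map e.symm.toEquiv.toEmbedding, ?_, ?_⟩
      · have := ht.map (f := e.symm.toEquiv.toEmbedding)
        refine SimpleGraph.IsNClique.mono ?_ this
        rw [SimpleGraph.map_le_iff_le_comap]
        intro a b hab
        exact e.symm.map_adj_iff.2 hab
      · ext x
        simp only [Finset.mem_map_equiv]
        change e (e.symm x) ∈ t ↔ _
        simp

/-! ### Gluings of diamonds -/

/-- A way of gluing diamonds indexed by `Q` along vertices in `P`: the vertex `p` has degree `2` in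
the diamond `tip p` and degree `3` in the diamond `hub p`. Every diamond has two vertices of either
kind. -/
structure DiamondGluing (P Q : Type*) where
  tip : P → Q
  hub : P → Q
  tip_fiber : ∀ x, (tip ⁻¹' {x}).ncard = 2
  hub_fiber : ∀ x, (hub ⁻¹' {x}).ncard = 2
  tip_ne_hub : ∀ p, tip p ≠ hub p

namespace DiamondGluing

variable {P Q : Type*} (D : DiamondGluing P Q)

/-- The union of the glued diamonds: two vertices are adjacent if they lie in a common diamond and at
least one of them has degree `3` there. -/
def graph : SimpleGraph P where
  Adj p q := p ≠ q ∧ (D.hub p = D.hub q ∨ D.hub p = D.tip q ∨ D.tip p = D.hub q)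
  symm := ⟨fun p q h => by grind⟩
  loopless := ⟨fun _ h => h.1 rfl⟩

theorem graph_adj {p q : P} : D.graph.Adj p q ↔
    p ≠ q ∧ (D.hub p = D.hub q ∨ D.hub p = D.tip q ∨ D.tip p = D.hub q) := Iff.rfl

/-- Two diamonds share at most one vertex. -/
def PairsUnique : Prop := ∀ p q,
  (D.tip p = D.tip q ∧ D.hub p = D.hub q) ∨ (D.tip p = D.hub q ∧ D.hub p = D.tip q) → p = q

/-- No three diamonds are glued cyclically, each by a degree `3` vertex to a degree `2` vertex of the
next one. -/
def NoCyclicTriple : Prop :=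
  ∀ p q r, D.hub p = D.tip q → D.hub q = D.tip r → D.hub r = D.tip p → False

/-- No two diamonds share two vertices with exchanged roles. This is what keeps the diamonds
edge-disjoint. -/
def NoAntiparallel : Prop := ∀ p q, D.hub p = D.tip q → D.hub q = D.tip p → False

variable {D}

theorem PairsUnique.noAntiparallel (h : D.PairsUnique) : D.NoAntiparallel := by
  intro p q h1 h2
  obtain rfl := h p q (.inr ⟨h2.symm, h1⟩)
  exact D.tip_ne_hub p h2.symm

variable (D)

/-! ### Degrees and triangles of the glued graph -/

theorem neighborSet_ncard_eq_five_iff [Finite P] (p : P) :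
    (D.graph.neighborSet p).ncard = 5 ↔ ∀ q, D.hub p = D.tip q → D.hub q = D.tip p → False := by
  have hN1 : ({q | D.hub q = D.hub p} \ {p}).ncard = 1 := by
    have := D.hub_fiber (D.hub p)
    change ({q | D.hub q = D.hub p}).ncard = 2 at this
    rw [Set.ncard_sdiff_singleton_of_mem (by simp), this]
  have hN2 : {q | D.tip q = D.hub p}.ncard = 2 := D.tip_fiber (D.hub p)
  have hN3 : {q | D.hub q = D.tip p}.ncard = 2 := D.hub_fiber (D.tip p)
  have hN : D.graph.neighborSet p = (({q | D.hub q = D.hub p} \ {p}) ∪ {q | D.tip q = D.hub p})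
      ∪ {q | D.hub q = D.tip p} := by
    ext q
    have := D.tip_ne_hub p
    simp only [SimpleGraph.mem_neighborSet, graph_adj, Set.mem_union, Set.mem_sdiff,
      Set.mem_ofPred_eq, Set.mem_singleton_iff]
    grind
  have hd : Disjoint ({q | D.hub q = D.hub p} \ {p}) {q | D.tip q = D.hub p} := by
    rw [Set.disjoint_left]
    rintro q ⟨h, -⟩ h'
    exact D.tip_ne_hub q (h'.trans h.symm)
  have hi := Set.ncard_union_add_ncard_inter (({q | D.hub q = D.hub p} \ {p}) ∪
    {q | D.tip q = D.hub p}) {q | D.hub q = D.tip p}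
  rw [← hN, Set.ncard_union_eq hd, hN1, hN2, hN3] at hi
  have : (D.graph.neighborSet p).ncard = 5 ↔ ((({q | D.hub q = D.hub p} \ {p}) ∪
    {q | D.tip q = D.hub p}) ∩ {q | D.hub q = D.tip p}).ncard = 0 := by omega
  rw [this, Set.ncard_eq_zero, Set.eq_empty_iff_forall_notMem]
  simp only [Set.mem_inter_iff, Set.mem_union, Set.mem_sdiff, Set.mem_ofPred_eq,
    Set.mem_singleton_iff]
  have := D.tip_ne_hub p
  grind

open Classical in
/-- The triangle in the diamond `tip p` that contains its degree `2` vertex `p`. -/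
noncomputable def triangle [Fintype P] (p : P) : Finset P :=
  insert p (Finset.univ.filter fun q => D.hub q = D.tip p)

theorem mem_triangle [Fintype P] {p q : P} : q ∈ D.triangle p ↔ q = p ∨ D.hub q = D.tip p := by
  simp [triangle]

theorem triangle_isNClique [Fintype P] (p : P) : D.graph.IsNClique 3 (D.triangle p) := by
  classical
  obtain ⟨u, v, huv, h⟩ := two_fiber_iff (D.hub_fiber (D.tip p))
  have h1 := (h u).2 (.inl rfl)
  have h2 := (h v).2 (.inr rfl)
  have := D.tip_ne_hub p
  rw [SimpleGraph.is3Clique_iff]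
  refine ⟨p, u, v, ?_, ?_, ?_, ?_⟩
  · simp only [graph_adj]; grind
  · simp only [graph_adj]; grind
  · simp only [graph_adj]; grind
  · ext q; simp [mem_triangle, h]

variable {D}

theorem NoAntiparallel.triangle_injective [Fintype P] (h : D.NoAntiparallel) :
    Function.Injective D.triangle := by
  intro p q hpq
  by_contra hne
  have h1 : q ∈ D.triangle p := hpq ▸ D.mem_triangle.2 (.inl rfl)
  have h2 : p ∈ D.triangle q := hpq ▸ D.mem_triangle.2 (.inl rfl)
  rw [mem_triangle] at h1 h2
  exact h p q (h2.resolve_left hne) (h1.resolve_left (Ne.symm hne))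

theorem NoAntiparallel.card_triangles_iff [Fintype P] (h : D.NoAntiparallel) :
    (D.graph.cliqueSet 3).ncard = Nat.card P ↔
      ∀ s, D.graph.IsNClique 3 s → ∃ p, D.triangle p = s := by
  have hsub : Set.range D.triangle ⊆ D.graph.cliqueSet 3 := by
    rintro _ ⟨p, rfl⟩; exact D.triangle_isNClique p
  have hc : (Set.range D.triangle).ncard = Nat.card P := by
    rw [← Set.image_univ, Set.ncard_image_of_injective _ h.triangle_injective, Set.ncard_univ]
  constructor
  · intro hcard s hs
    have := Set.eq_of_subset_of_ncard_le hsub (by omega)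
    exact this.ge (show s ∈ D.graph.cliqueSet 3 from hs)
  · intro hall
    rw [← hc]
    congr 1
    exact (hsub.antisymm fun s hs => hall s hs).symm

theorem pairsUnique_of_triangles [Fintype P] (h : D.NoAntiparallel)
    (ht : ∀ s, D.graph.IsNClique 3 s → ∃ p, D.triangle p = s) : D.PairsUnique := by
  classical
  rintro p q (⟨h1, h2⟩ | ⟨h1, h2⟩)
  · by_contra hne
    -- The edge `p q` lies in the diamond of the common hub, and `p`, `q` are both adjacent to the
    -- degree `3` vertices `b` of the diamond of the common tip.
    obtain ⟨b, _, _, hb⟩ := two_fiber_iff (D.hub_fiber (D.tip p))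
    have hb := (hb b).2 (.inl rfl)
    have hp := D.tip_ne_hub p
    have hq := D.tip_ne_hub q
    obtain ⟨r, hr⟩ := ht {p, q, b} (by
      rw [SimpleGraph.is3Clique_triple_iff]; simp only [graph_adj]; grind)
    have m (x : P) := D.mem_triangle (p := r) (q := x)
    rw [hr] at m
    simp only [Finset.mem_insert, Finset.mem_singleton] at m
    have mp := m p
    have mq := m q
    have mb := m b
    have mr := m r
    have := h p b
    grind
  · exact (h p q h2 h1.symm).elim

theorem noCyclicTriple_of_triangles [Fintype P] (h : D.NoAntiparallel)
    (ht : ∀ s, D.graph.IsNClique 3 s → ∃ p, D.triangle p = s) : D.NoCyclicTriple := by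
  classical
  intro p q r h1 h2 h3
  have hp := D.tip_ne_hub p
  have hq := D.tip_ne_hub q
  have hr := D.tip_ne_hub r
  obtain ⟨s, hs⟩ := ht {p, q, r} (by
    rw [SimpleGraph.is3Clique_triple_iff]; simp only [graph_adj]; grind)
  have m (x : P) := D.mem_triangle (p := s) (q := x)
  rw [hs] at m
  simp only [Finset.mem_insert, Finset.mem_singleton] at m
  have mp := m p
  have mq := m q
  have mr := m r
  have ms := m s
  have := h p q
  have := h q r
  have := h r p
  grind

theorem triangle_eq_of_isNClique [Fintype P] {s : Finset P} {p : P}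
    (hs : D.graph.IsNClique 3 s) (hsub : s ⊆ D.triangle p) : D.triangle p = s :=
  (Finset.eq_of_subset_of_card_le hsub
    (by rw [hs.card_eq, (D.triangle_isNClique p).card_eq])).symm

/-- A triangle on the two degree `3` vertices of a diamond lies in that diamond. -/
theorem hub_eq_tip_of_hub_eq [Fintype P] (h : D.PairsUnique) {a b c : P}
    (hab : a ≠ b) (hh : D.hub a = D.hub b) (hac : D.graph.Adj a c) (hbc : D.graph.Adj b c) :
    D.hub a = D.tip c := by
  obtain ⟨u, v, huv, hf⟩ := two_fiber_iff (D.hub_fiber (D.hub a))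
  have fa := hf a
  have fb := hf b
  have fc := hf c
  have hA := h.noAntiparallel
  have := hA a c
  have := hA b c
  have := h a b
  have := D.tip_ne_hub a
  have := D.tip_ne_hub b
  have := D.tip_ne_hub c
  simp only [graph_adj] at hac hbc
  grind

theorem exists_triangle_eq [Fintype P] (h : D.PairsUnique) (hc : D.NoCyclicTriple) (s : Finset P)
    (hs : D.graph.IsNClique 3 s) : ∃ p, D.triangle p = s := by
  classical
  have hs' := hs
  rw [SimpleGraph.is3Clique_iff] at hs'
  obtain ⟨a, b, c, hab, hac, hbc, rfl⟩ := hs'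
  suffices ∃ p, ({a, b, c} : Finset P) ⊆ D.triangle p by
    obtain ⟨p, hp⟩ := this
    exact ⟨p, triangle_eq_of_isNClique hs hp⟩
  simp only [Finset.insert_subset_iff, Finset.singleton_subset_iff, mem_triangle]
  by_cases e1 : D.hub a = D.hub b
  · have := hub_eq_tip_of_hub_eq h hab.ne e1 hac hbc
    exact ⟨c, by grind⟩
  by_cases e2 : D.hub a = D.hub c
  · have := hub_eq_tip_of_hub_eq h hac.ne e2 hab hbc.symm
    exact ⟨b, by grind⟩
  by_cases e3 : D.hub b = D.hub c
  · have := hub_eq_tip_of_hub_eq h hbc.ne e3 hab.symm hac.symm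
    exact ⟨a, by grind⟩
  -- All hubs differ, so each edge goes from a hub to a tip; distinct hubs force a cyclic orientation.
  have := hc a b c
  have := hc a c b
  simp only [graph_adj] at hab hac hbc
  grind

theorem exists_common_neighbor (p q : P) (h : D.graph.Adj p q) :
    ∃ r, D.graph.Adj p r ∧ D.graph.Adj q r := by
  obtain ⟨r, _, _, hr⟩ := two_fiber_iff (D.tip_fiber (D.hub p))
  have hr := (hr r).2 (.inl rfl)
  obtain ⟨u, v, huv, hu⟩ := two_fiber_iff (D.hub_fiber (D.hub p))
  obtain ⟨u', v', huv', hu'⟩ := two_fiber_iff (D.hub_fiber (D.hub q))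
  have := D.tip_ne_hub p
  have := D.tip_ne_hub q
  have := D.tip_ne_hub r
  simp only [graph_adj] at h ⊢
  obtain ⟨hne, h | h | h⟩ := h
  · exact ⟨r, by grind⟩
  · by_cases hp : p = u
    · exact ⟨v, by grind⟩
    · exact ⟨u, by grind⟩
  · by_cases hp : q = u'
    · exact ⟨v', by grind⟩
    · exact ⟨u', by grind⟩

theorem isOptimalQuintic_graph_iff [Finite P] {n : ℕ} (hn : Nat.card P = 2 * n) :
    IsOptimalQuintic D.graph n ↔ D.PairsUnique ∧ D.NoCyclicTriple := by
  have := Fintype.ofFinite P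
  constructor
  · intro h
    have hA : D.NoAntiparallel := fun p => (D.neighborSet_ncard_eq_five_iff p).1 (h.regular p)
    have ht := hA.card_triangles_iff.1 (h.card_triangles.trans hn.symm)
    exact ⟨pairsUnique_of_triangles hA ht, noCyclicTriple_of_triangles hA ht⟩
  · rintro ⟨h1, h2⟩
    have hA := h1.noAntiparallel
    exact
      { finite := inferInstance
        card_eq := hn
        regular := fun p => (D.neighborSet_ncard_eq_five_iff p).2 (hA p)
        triangle_property := exists_common_neighbor
        card_triangles := hn ▸ hA.card_triangles_iff.2 (exists_triangle_eq h1 h2) }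

end DiamondGluing

/-! ### Triangles in an optimal quintic graph -/

section OptimalStructure

open Finset

variable {W : Type*} [Fintype W] [DecidableEq W] {G : SimpleGraph W} [DecidableRel G.Adj]

variable (G) in
/-- The triangles of `G` that contain both `v` and `w`; for `v = w`, the triangles at `v`. -/
def trianglesThrough (v w : W) : Finset (Finset W) :=
  (G.cliqueFinset 3).filter fun t => v ∈ t ∧ w ∈ t

theorem mem_trianglesThrough {v w : W} {t : Finset W} :
    t ∈ trianglesThrough G v w ↔ G.IsNClique 3 t ∧ v ∈ t ∧ w ∈ t := by
  simp [trianglesThrough]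

theorem trianglesThrough_comm (v w : W) : trianglesThrough G v w = trianglesThrough G w v := by
  ext t; simp only [mem_trianglesThrough]; tauto

theorem exists_eq_of_mem_trianglesThrough {v w : W} {t : Finset W} (hvw : v ≠ w)
    (ht : t ∈ trianglesThrough G v w) :
    ∃ x, G.Adj x v ∧ G.Adj x w ∧ G.Adj v w ∧ t = {x, v, w} := by
  obtain ⟨h, hv, hw⟩ := mem_trianglesThrough.1 ht
  obtain ⟨a, b, c, hab, hac, hbc, rfl⟩ := SimpleGraph.is3Clique_iff.1 h
  have := hab.symm
  have := hac.symm
  have := hbc.symm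
  simp only [mem_insert, mem_singleton] at hv hw
  rcases hv with rfl | rfl | rfl <;> rcases hw with rfl | rfl | rfl <;>
    first
    | exact absurd rfl hvw
    | exact ⟨a, by assumption, by assumption, by assumption, by grind⟩
    | exact ⟨b, by assumption, by assumption, by assumption, by grind⟩
    | exact ⟨c, by assumption, by assumption, by assumption, by grind⟩

theorem card_trianglesThrough {v w : W} (hvw : G.Adj v w) :
    #(trianglesThrough G v w) = {x | G.Adj x v ∧ G.Adj x w}.ncard := by
  rw [← Set.ncard_coe_finset]
  symm
  refine Set.ncard_congr (fun x _ => {x, v, w}) ?_ ?_ ?_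
  · rintro x ⟨h1, h2⟩
    simp only [mem_coe, mem_trianglesThrough, SimpleGraph.is3Clique_triple_iff]
    simp [*]
  · rintro x y ⟨h1, h2⟩ ⟨h3, h4⟩ h
    have : x ∈ ({y, v, w} : Finset W) := h ▸ mem_insert_self _ _
    simpa [h1.ne, h2.ne] using this
  · intro t ht
    obtain ⟨x, h1, h2, -, rfl⟩ := exists_eq_of_mem_trianglesThrough hvw.ne ht
    exact ⟨x, ⟨h1, h2⟩, rfl⟩

theorem neighborFinset_subset_biUnion_erase (ht : ∀ u v, G.Adj u v → ∃ w, G.Adj u w ∧ G.Adj v w)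
    (v : W) : G.neighborFinset v ⊆ (trianglesThrough G v v).biUnion fun t => t.erase v := by
  intro w hw
  rw [SimpleGraph.mem_neighborFinset] at hw
  obtain ⟨x, h1, h2⟩ := ht v w hw
  rw [mem_biUnion]
  refine ⟨{v, w, x}, ?_, by simp [hw.ne']⟩
  rw [mem_trianglesThrough, SimpleGraph.is3Clique_triple_iff]
  simp [*]

theorem three_le_card_trianglesThrough_self
    (hreg : ∀ v, (G.neighborSet v).ncard = 5)
    (ht : ∀ u v, G.Adj u v → ∃ w, G.Adj u w ∧ G.Adj v w) (v : W) :
    3 ≤ #(trianglesThrough G v v) := by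
  have h1 := card_le_card (neighborFinset_subset_biUnion_erase ht v)
  have h2 : #((trianglesThrough G v v).biUnion fun t => t.erase v) ≤
      #(trianglesThrough G v v) * 2 := by
    refine card_biUnion_le_card_mul _ _ _ fun t h => ?_
    obtain ⟨h, hv, -⟩ := mem_trianglesThrough.1 h
    rw [card_erase_of_mem hv, h.card_eq]
  have h3 : #(G.neighborFinset v) = 5 := by
    rw [← hreg v, ← Set.ncard_coe_finset, SimpleGraph.coe_neighborFinset]
  omega

theorem sum_card_trianglesThrough_self :
    ∑ v, #(trianglesThrough G v v) = 3 * #(G.cliqueFinset 3) := by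
  have := sum_card_bipartiteAbove_eq_sum_card_bipartiteBelow
    (s := (univ : Finset W)) (t := G.cliqueFinset 3) (fun v t => v ∈ t)
  simp only [bipartiteAbove, bipartiteBelow] at this
  simp only [trianglesThrough, and_self]
  rw [this, sum_const_nat (m := 3), mul_comm]
  intro t ht
  rw [filter_mem_eq_inter, univ_inter]
  exact (G.mem_cliqueFinset_iff.1 ht).card_eq

theorem card_trianglesThrough_self {n : ℕ} (h : IsOptimalQuintic G n) (v : W) :
    #(trianglesThrough G v v) = 3 := by
  have hle : ∀ v ∈ (univ : Finset W), 3 ≤ #(trianglesThrough G v v) := fun v _ =>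
    three_le_card_trianglesThrough_self h.regular h.triangle_property v
  refine (((sum_eq_sum_iff_of_le hle).1 ?_) v (mem_univ _)).symm
  rw [sum_card_trianglesThrough_self, ← Set.ncard_coe_finset, SimpleGraph.coe_cliqueFinset,
    h.card_triangles, ← h.card_eq, sum_const, card_univ, Nat.card_eq_fintype_card, smul_eq_mul,
    mul_comm]

theorem sum_card_trianglesThrough {n : ℕ} (h : IsOptimalQuintic G n) (v : W) :
    ∑ w ∈ G.neighborFinset v, #(trianglesThrough G v w) = 6 := by
  have := sum_card_bipartiteAbove_eq_sum_card_bipartiteBelow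
    (s := G.neighborFinset v) (t := trianglesThrough G v v) (fun w t => w ∈ t)
  simp only [bipartiteAbove, bipartiteBelow] at this
  have e (w : W) : trianglesThrough G v w = (trianglesThrough G v v).filter fun t => w ∈ t := by
    ext t; simp only [mem_filter, mem_trianglesThrough]; tauto
  rw [sum_congr rfl fun w _ => congrArg card (e w)]
  rw [this, sum_const_nat (m := 2), card_trianglesThrough_self h]
  intro t ht
  obtain ⟨ht, hv, -⟩ := mem_trianglesThrough.1 ht
  have : (G.neighborFinset v).filter (fun w => w ∈ t) = t.erase v := by
    ext w
    rw [mem_filter, SimpleGraph.mem_neighborFinset, mem_erase]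
    exact ⟨fun h => ⟨h.1.ne', h.2⟩, fun h => ⟨ht.isClique hv h.2 h.1.symm, h.2⟩⟩
  rw [this, card_erase_of_mem hv, ht.card_eq]

theorem card_trianglesThrough_pos {n : ℕ} (h : IsOptimalQuintic G n) {v w : W}
    (hvw : G.Adj v w) : 1 ≤ #(trianglesThrough G v w) := by
  obtain ⟨x, h1, h2⟩ := h.triangle_property v w hvw
  refine card_pos.2 ⟨{v, w, x}, ?_⟩
  rw [mem_trianglesThrough, SimpleGraph.is3Clique_triple_iff]
  simp [*]

/-- The five neighbors of `v` share `6` triangles with it, counted with multiplicity, and each shares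
at least one, so exactly one neighbor shares two. -/
theorem exists_partner {n : ℕ} (h : IsOptimalQuintic G n) (v : W) :
    ∃ w, G.Adj v w ∧ #(trianglesThrough G v w) = 2 ∧
      ∀ x, G.Adj v x → x ≠ w → #(trianglesThrough G v x) = 1 := by
  have hsum := sum_card_trianglesThrough h v
  have hN : #(G.neighborFinset v) = 5 := by
    rw [← h.regular v, ← Set.ncard_coe_finset, SimpleGraph.coe_neighborFinset]
  obtain ⟨w, hw, hw2⟩ : ∃ w ∈ G.neighborFinset v, 1 < #(trianglesThrough G v w) := by
    refine exists_lt_of_sum_lt ?_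
    rw [hsum, sum_const, hN]; simp
  have hle : ∀ x ∈ G.neighborFinset v,
      (1 + if x = w then 1 else 0) ≤ #(trianglesThrough G v x) := by
    intro x hx
    split_ifs with hxw
    · subst hxw; omega
    · exact card_trianglesThrough_pos h (by simpa using hx)
  have heq := (sum_eq_sum_iff_of_le hle).1 (by
    rw [hsum, sum_add_distrib, sum_const, hN, sum_ite_eq_of_mem' _ _ _ hw]; simp)
  refine ⟨w, by simpa using hw, by simpa using (heq w hw).symm, fun x hx hxw => ?_⟩
  simpa [hxw] using (heq x (by simpa using hx)).symm

/-! ### The partner matching -/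

variable {σ : W → W}

theorem partner_involutive (h1 : ∀ v, G.Adj v (σ v))
    (h2 : ∀ v, #(trianglesThrough G v (σ v)) = 2)
    (h3 : ∀ v w, G.Adj v w → w ≠ σ v → #(trianglesThrough G v w) = 1) :
    Function.Involutive σ := by
  intro v
  by_contra hne
  have := h3 (σ v) v (h1 v).symm (Ne.symm hne)
  rw [trianglesThrough_comm, h2] at this
  omega

omit [Fintype W] in
theorem card_filter_partner_mem_le (hσ : Function.Involutive σ) (h1 : ∀ v, σ v ≠ v)
    {t : Finset W} (ht : #t = 3) : #(t.filter fun v => σ v ∈ t) ≤ 2 := by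
  by_contra! hlt
  have hall : ∀ v ∈ t, σ v ∈ t := by
    rw [← filter_eq_self]
    exact eq_of_subset_of_card_le (filter_subset _ _) (by omega)
  obtain ⟨a, b, c, hab, hac, hbc, rfl⟩ := card_eq_three.1 ht
  simp only [mem_insert, mem_singleton, forall_eq_or_imp, forall_eq] at hall
  have := hσ a
  have := hσ b
  have := hσ c
  have := h1 a
  have := h1 b
  have := h1 c
  grind

/-- Every triangle contains a partner pair: each of the `2n` vertices shares two triangles with its
partner, and each of the `2n` triangles accounts for at most two of these `4n` incidences. -/
theorem card_filter_partner_mem {n : ℕ} (h : IsOptimalQuintic G n)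
    (hσ : Function.Involutive σ) (h1 : ∀ v, σ v ≠ v)
    (h2 : ∀ v, #(trianglesThrough G v (σ v)) = 2) {t : Finset W} (ht : G.IsNClique 3 t) :
    #(t.filter fun v => σ v ∈ t) = 2 := by
  have hle : ∀ t ∈ G.cliqueFinset 3, #(t.filter fun v => σ v ∈ t) ≤ 2 := fun t ht =>
    card_filter_partner_mem_le hσ h1 (G.mem_cliqueFinset_iff.1 ht).card_eq
  refine (sum_eq_sum_iff_of_le hle).1 ?_ t (G.mem_cliqueFinset_iff.2 ht)
  have := sum_card_bipartiteAbove_eq_sum_card_bipartiteBelow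
    (s := (univ : Finset W)) (t := G.cliqueFinset 3) (fun v t => v ∈ t ∧ σ v ∈ t)
  simp only [bipartiteAbove, bipartiteBelow] at this
  simp only [trianglesThrough] at h2
  have e (t : Finset W) : (t.filter fun v => σ v ∈ t) = univ.filter fun v => v ∈ t ∧ σ v ∈ t := by
    ext; simp
  simp only [e]
  rw [← this]
  simp only [h2]
  rw [sum_const, sum_const, card_univ, ← Nat.card_eq_fintype_card, h.card_eq,
    ← Set.ncard_coe_finset (G.cliqueFinset 3), SimpleGraph.coe_cliqueFinset, h.card_triangles]

theorem existsUnique_partner_notMem {n : ℕ} (h : IsOptimalQuintic G n)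
    (hσ : Function.Involutive σ) (h1 : ∀ v, σ v ≠ v)
    (h2 : ∀ v, #(trianglesThrough G v (σ v)) = 2) {t : Finset W} (ht : G.IsNClique 3 t) :
    ∃! v, v ∈ t ∧ σ v ∉ t := by
  have h3 := card_filter_partner_mem h hσ h1 h2 ht
  have h4 := card_filter_add_card_filter_not (s := t) (fun v => σ v ∈ t)
  rw [ht.card_eq] at h4
  obtain ⟨v, hv⟩ := card_eq_one.1 (show #(t.filter fun v => σ v ∉ t) = 1 by omega)
  have hv' (w : W) := Finset.ext_iff.1 hv w
  simp only [mem_filter, mem_singleton] at hv'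
  exact ⟨v, (hv' v).2 rfl, fun w => (hv' w).1⟩

theorem existsUnique_triangle_partner_notMem {n : ℕ} (h : IsOptimalQuintic G n)
    (h2 : ∀ v, #(trianglesThrough G v (σ v)) = 2) (v : W) :
    ∃! t, G.IsNClique 3 t ∧ v ∈ t ∧ σ v ∉ t := by
  have h3 := card_trianglesThrough_self h v
  have h4 := card_filter_add_card_filter_not (s := trianglesThrough G v v) (fun t => σ v ∈ t)
  have e : ((trianglesThrough G v v).filter fun t => σ v ∈ t) = trianglesThrough G v (σ v) := by
    ext t; simp only [mem_filter, mem_trianglesThrough]; tauto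
  rw [e, h2, h3] at h4
  obtain ⟨t, ht⟩ := card_eq_one.1
    (show #((trianglesThrough G v v).filter fun t => σ v ∉ t) = 1 by omega)
  have ht' (s : Finset W) := Finset.ext_iff.1 ht s
  simp only [mem_filter, mem_singleton, mem_trianglesThrough] at ht'
  refine ⟨t, by have := (ht' t).2 rfl; tauto, fun s hs => (ht' s).1 (by tauto)⟩

omit [Fintype W] in
theorem eq_insert_partner {t : Finset W} {v a : W} (hσ : Function.Involutive σ)
    (h1 : ∀ v, σ v ≠ v) (ht : #t = 3) (hv : v ∈ t) (hσv : σ v ∉ t)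
    (huniq : ∀ w, w ∈ t ∧ σ w ∉ t → w = v) (ha : a ∈ t) (hav : a ≠ v) :
    t = {v, a, σ a} := by
  have haσ : σ a ∈ t := by
    by_contra hn
    exact hav (huniq a ⟨ha, hn⟩)
  have := h1 a
  have := hσ a
  have hsub : ({v, a, σ a} : Finset W) ⊆ t := by
    simp [insert_subset_iff, *]
  refine (eq_of_subset_of_card_le hsub ?_).symm
  rw [ht, card_eq_three.2 ⟨v, a, σ a, by grind, by grind, by grind, rfl⟩]

end OptimalStructure

/-- An optimal quintic graph is a union of `n` glued diamonds, one for each partner pair. -/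
theorem IsOptimalQuintic.exists_diamondGluing {W : Type*} {G : SimpleGraph W} {n : ℕ}
    (h : IsOptimalQuintic G n) : ∃ D : DiamondGluing W (Fin n), D.graph = G := by
  classical
  have := h.finite
  have := Fintype.ofFinite W
  choose σ h1 h2 h3 using exists_partner h
  have hσ := partner_involutive h1 h2 h3
  have hne : ∀ v, σ v ≠ v := fun v => (h1 v).ne'
  -- `T v` is the triangle at `v` that avoids the partner of `v`; it is `{v, a v, σ (a v)}`.
  choose T hT hTu using existsUnique_triangle_partner_notMem h h2
  have hTu' : ∀ v w, w ∈ T v ∧ σ w ∉ T v → w = v := fun v w hw =>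
    (existsUnique_partner_notMem h hσ hne h2 (hT v).1).unique hw (hT v).2
  have hex : ∀ v, ∃ a, T v = {v, a, σ a} := by
    intro v
    obtain ⟨a, ha, hav⟩ := Finset.exists_mem_ne (s := T v) (by rw [(hT v).1.card_eq]; simp) v
    exact ⟨a, eq_insert_partner hσ hne (hT v).1.card_eq (hT v).2.1 (hT v).2.2 (hTu' v) ha hav⟩
  choose a ha using hex
  have haT : ∀ v, G.Adj v (a v) ∧ G.Adj v (σ (a v)) := by
    intro v
    have := (hT v).1
    rw [ha v, SimpleGraph.is3Clique_triple_iff] at this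
    exact ⟨this.1, this.2.1⟩
  have haσ : ∀ v, a v ≠ v ∧ a v ≠ σ v := by
    intro v
    have := (hT v).2.2
    rw [ha v] at this
    have := (haT v).1.ne
    grind
  have hau : ∀ v b, G.Adj v b → G.Adj v (σ b) → a v = b ∨ a v = σ b := by
    intro v b hb hb'
    have : {v, b, σ b} = T v := by
      refine hTu v _ ⟨?_, by simp, ?_⟩
      · rw [SimpleGraph.is3Clique_triple_iff]
        exact ⟨hb, hb', h1 b⟩
      · have := hb.ne
        have := hb'.ne
        have := hne v
        have := hσ v
        have := hσ b
        grind
    have hav : a v ∈ ({v, b, σ b} : Finset W) := by rw [this, ha v]; simp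
    have := haσ v
    simp only [Finset.mem_insert, Finset.mem_singleton] at hav
    tauto
  have hcover : ∀ u v, G.Adj u v → v = σ u ∨ (v = a u ∨ v = σ (a u)) ∨ (u = a v ∨ u = σ (a v)) := by
    intro u v huv
    obtain ⟨x, hux, hvx⟩ := h.triangle_property u v huv
    have ht : G.IsNClique 3 {u, v, x} := by
      rw [SimpleGraph.is3Clique_triple_iff]; exact ⟨huv, hux, hvx⟩
    obtain ⟨w, hw, -⟩ := existsUnique_partner_notMem h hσ hne h2 ht
    have he := hTu w _ ⟨ht, hw⟩
    rw [ha w] at he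
    have hu : u ∈ ({w, a w, σ (a w)} : Finset W) := he ▸ by simp
    have hv : v ∈ ({w, a w, σ (a w)} : Finset W) := he ▸ by simp
    simp only [Finset.mem_insert, Finset.mem_singleton] at hu hv
    have := huv.ne
    have := hσ (a w)
    grind
  -- The diamonds are the partner pairs `{v, σ v}`.
  let S : Setoid W := ⟨fun u v => u = v ∨ u = σ v, fun u => .inl rfl,
    fun {u v} h => by have := hσ v; grind, fun {u v w} h h' => by have := hσ w; grind⟩
  have hmk : ∀ u v, Quotient.mk S u = Quotient.mk S v ↔ u = v ∨ u = σ v := fun u v => Quotient.eq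
  have hub_fiber : ∀ x, (Quotient.mk S ⁻¹' {x}).ncard = 2 := by
    intro x
    induction x using Quotient.ind with | _ v
    rw [Set.ncard_eq_two]
    exact ⟨v, σ v, (hne v).symm, by ext u; simpa using hmk u v⟩
  have hcard : Nat.card (Quotient S) = n := by
    have := card_eq_two_mul_of_two_fibers hub_fiber
    rw [h.card_eq] at this
    omega
  have tip_fiber : ∀ x, ((fun v => Quotient.mk S (a v)) ⁻¹' {x}).ncard = 2 := by
    intro x
    induction x using Quotient.ind with | _ b
    -- `tip v` is the pair of `b` iff `v` is a common neighbor of `b` and `σ b`.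
    rw [← h2 b, card_trianglesThrough (h1 b)]
    congr 1
    ext v
    simp only [Set.mem_preimage, Set.mem_singleton_iff, hmk, Set.mem_ofPred_eq]
    constructor
    · have := haT v
      have := hσ b
      grind
    · rintro ⟨h, h'⟩
      exact hau v b h h'
  let e : Quotient S ≃ Fin n := (Finite.equivFin _).trans (finCongr hcard)
  refine ⟨⟨fun v => e (Quotient.mk S (a v)), fun v => e (Quotient.mk S v), ?_, ?_, ?_⟩, ?_⟩
  · intro x
    rw [← tip_fiber (e.symm x)]
    congr 1; ext v; simp [Equiv.eq_symm_apply]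
  · intro x
    rw [← hub_fiber (e.symm x)]
    congr 1; ext v; simp [Equiv.eq_symm_apply]
  · intro v
    rw [Ne, e.injective.eq_iff, hmk]
    have := haσ v
    tauto
  · ext u v
    rw [DiamondGluing.graph_adj]
    simp only [e.injective.eq_iff, hmk]
    constructor
    · rintro ⟨huv, (h | h) | (h | h) | h | h⟩
      · exact absurd h huv
      · rw [h]; exact (h1 v).symm
      · rw [h]; exact (haT v).1.symm
      · rw [h]; exact (haT v).2.symm
      · rw [← h]; exact (haT u).1
      · rw [← hσ v, ← h]; exact (haT u).2
    · intro huv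
      refine ⟨huv.ne, ?_⟩
      obtain rfl | (rfl | h) | h | h := hcover u v huv
      · exact .inl (.inr (hσ u).symm)
      · exact .inr (.inr (.inl rfl))
      · exact .inr (.inr (.inr (by rw [h, hσ])))
      · exact .inr (.inl (.inl h))
      · exact .inr (.inl (.inr h))

/-! ### Alternating cycles of two involutions -/

section AlternatingCycles

variable {P : Type*} {σ τ : P → P}

/-- In the dihedral group generated by `σ` and `τ`, every reflection is conjugate to `σ` or `τ`, so it
has no fixed point if these have none. -/
theorem zpow_apply_ne_of_involutive {σ τ : Equiv.Perm P} (hσ : Function.Involutive σ)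
    (hτ : Function.Involutive τ) (hσ' : ∀ p, σ p ≠ p) (hτ' : ∀ p, τ p ≠ p) (i : ℤ) (p : P) :
    ((τ * σ) ^ i) p ≠ σ p := by
  have hσ2 : σ⁻¹ = σ := by ext x; rw [Equiv.Perm.inv_eq_iff_eq, hσ]
  have hτ2 : τ⁻¹ = τ := by ext x; rw [Equiv.Perm.inv_eq_iff_eq, hτ]
  have hconj : ∀ k : ℤ, σ * (τ * σ) ^ k = (τ * σ) ^ (-k) * σ := by
    intro k
    have h1 : σ * (τ * σ) * σ⁻¹ = (τ * σ)⁻¹ := by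
      rw [mul_inv_rev, hσ2, hτ2]
      ext x
      simp [Equiv.Perm.mul_apply, hσ x]
    have h2 := conj_zpow (i := k) (a := σ) (b := τ * σ)
    rw [h1, inv_zpow, ← zpow_neg] at h2
    rw [h2]; group
  intro h
  obtain ⟨k, hk | hk⟩ := Int.even_or_odd' i
  · apply hσ' (((τ * σ) ^ k) p)
    rw [← Equiv.Perm.mul_apply, hconj, Equiv.Perm.mul_apply, ← h, ← Equiv.Perm.mul_apply,
      ← zpow_add, hk]
    congr 2; ring
  · apply hτ' (σ (((τ * σ) ^ k) p))
    have : τ (σ (((τ * σ) ^ k) p)) = ((τ * σ) ^ (k + 1)) p := by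
      rw [add_comm k, zpow_add, zpow_one]; rfl
    rw [this, ← Equiv.Perm.mul_apply, hconj, Equiv.Perm.mul_apply, ← h, ← Equiv.Perm.mul_apply,
      ← zpow_add, hk]
    congr 2; ring

/-- Two fixed-point-free involutions admit a set that both of them exchange with its complement, i.e.
the union of two perfect matchings is bipartite. -/
theorem exists_set_alternating (hσ : Function.Involutive σ)
    (hτ : Function.Involutive τ) (hσ' : ∀ p, σ p ≠ p) (hτ' : ∀ p, τ p ≠ p) :
    ∃ A : Set P, (∀ p, σ p ∈ A ↔ p ∉ A) ∧ ∀ p, τ p ∈ A ↔ p ∉ A := by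
  classical
  let ρ : Equiv.Perm P := hτ.toPerm τ * hσ.toPerm σ
  have hρ : ∀ p, ρ p = τ (σ p) := fun p => rfl
  let S := Equiv.Perm.SameCycle.setoid ρ
  let c : P → Quotient S := Quotient.mk S
  have hc : ∀ p q, c p = c q ↔ ρ.SameCycle p q := fun p q => Quotient.eq
  have h1 : ∀ p, c p ≠ c (σ p) := by
    intro p h
    obtain ⟨i, hi⟩ := (hc _ _).1 h
    exact zpow_apply_ne_of_involutive (σ := hσ.toPerm σ) (τ := hτ.toPerm τ) hσ hτ hσ' hτ' i p hi
  have h2 : ∀ p, c (τ p) = c (σ p) := by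
    intro p
    rw [hc, Equiv.Perm.sameCycle_comm]
    exact ⟨1, by rw [zpow_one, hρ, hσ]⟩
  have h3 : ∀ p, c (σ (τ p)) = c p := by
    intro p
    rw [hc]
    exact ⟨1, by rw [zpow_one, hρ, hσ, hτ]⟩
  let r : Quotient S → Quotient S → Prop := WellOrderingRel
  have htri : ∀ x y, x ≠ y → (r x y ↔ ¬ r y x) := by
    intro x y hxy
    constructor
    · exact fun h => asymm h
    · intro h
      rcases trichotomous_of r x y with h' | h' | h'
      · exact h'
      · exact absurd h' hxy
      · exact absurd h' h
  -- `σ` and `τ` exchange the same two cycles of `τ ∘ σ`; the set takes the smaller of the two for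
  -- some linear order.
  refine ⟨{p | r (c p) (c (σ p))}, fun p => ?_, fun p => ?_⟩
  · change r (c (σ p)) (c (σ (σ p))) ↔ ¬ r (c p) (c (σ p))
    rw [hσ, htri _ _ (h1 p).symm]
  · change r (c (τ p)) (c (σ (τ p))) ↔ ¬ r (c p) (c (σ p))
    rw [h2, h3, htri _ _ (h1 p).symm]

theorem val_finRotate {m : ℕ} (i : Fin m) : (finRotate m i : ℕ) = (i + 1) % m := by
  cases m with
  | zero => exact i.elim0
  | succ m => rw [finRotate_apply, Fin.val_add]; simp

/-- A permutation of a finite set that exchanges `A` with its complement is a disjoint union of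
rotations of even length, each of them listed from an element of `A`. -/
theorem exists_cycles_of_alternating [Finite P] (π : Equiv.Perm P) (A : Set P)
    (hA : ∀ p, π p ∈ A ↔ p ∉ A) :
    ∃ (N : ℕ) (l : Fin N → ℕ) (f : (Σ c, Fin (2 * l c)) ≃ P), (∀ c, 0 < l c) ∧
      (∀ c i, f ⟨c, finRotate _ i⟩ = π (f ⟨c, i⟩)) ∧
      ∀ c i, f ⟨c, i⟩ ∈ A ↔ Even (i : ℕ) := by
  classical
  let S := Equiv.Perm.SameCycle.setoid π
  have hS : ∀ p q, Quotient.mk S p = Quotient.mk S q ↔ π.SameCycle p q := fun p q => Quotient.eq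
  have hrep : ∀ x : Quotient S, ∃ p ∈ A, Quotient.mk S p = x := by
    intro x
    induction x using Quotient.ind with | _ p
    by_cases hp : p ∈ A
    · exact ⟨p, hp, rfl⟩
    · exact ⟨π p, (hA p).2 hp, (hS _ _).2 ⟨-1, by simp⟩⟩
  choose r hrA hr using hrep
  have hpar : ∀ x (i : ℕ), (π^[i]) (r x) ∈ A ↔ Even i := by
    intro x i
    induction i with
    | zero => simpa using hrA x
    | succ i ih => rw [Function.iterate_succ_apply', hA, ih, Nat.even_add_one]
  have hper : ∀ p, p ∈ Function.periodicPts π := fun p =>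
    π.injective.mem_periodicPts p
  let m : Quotient S → ℕ := fun x => Function.minimalPeriod π (r x)
  have hm0 : ∀ x, 0 < m x := fun x => Function.minimalPeriod_pos_of_mem_periodicPts (hper _)
  have hm2 : ∀ x, 2 * (m x / 2) = m x := by
    intro x
    apply Nat.two_mul_div_two_of_even
    rw [← hpar x]
    exact (Function.iterate_minimalPeriod (f := π) (x := r x)).symm ▸ hrA x
  let e := Finite.equivFin (Quotient S)
  let l : Fin (Nat.card (Quotient S)) → ℕ := fun c => m (e.symm c) / 2
  let f : (Σ c, Fin (2 * l c)) → P := fun p => π^[p.2] (r (e.symm p.1))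
  have hsame : ∀ x (i : ℕ), Quotient.mk S (π^[i] (r x)) = x := by
    intro x i
    conv_rhs => rw [← hr x]
    rw [hS, Equiv.Perm.sameCycle_comm]
    exact ⟨i, by rw [zpow_natCast, ← Equiv.Perm.iterate_eq_pow]⟩
  have hf : Function.Bijective f := by
    constructor
    · rintro ⟨c, i⟩ ⟨d, j⟩ h
      have hcd : e.symm c = e.symm d := by
        rw [← hsame (e.symm c) i, ← hsame (e.symm d) j]
        exact congrArg _ h
      obtain rfl := e.symm.injective hcd
      have hi := i.2
      have hj := j.2
      simp only [l, hm2] at hi hj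
      have := (Function.iterate_eq_iterate_iff_of_lt_minimalPeriod hi hj).1 h
      rw [Fin.ext this]
    · intro p
      obtain ⟨i, hi⟩ := ((hS _ _).1 (hr (Quotient.mk S p))).exists_nat_pow_eq
      rw [← Equiv.Perm.iterate_eq_pow] at hi
      have hlt : i % m (Quotient.mk S p) < 2 * l (e (Quotient.mk S p)) := by
        simp only [l, Equiv.symm_apply_apply, hm2]
        exact Nat.mod_lt _ (hm0 _)
      refine ⟨⟨e (Quotient.mk S p), ⟨_, hlt⟩⟩, ?_⟩
      simp only [f, Equiv.symm_apply_apply]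
      exact Function.iterate_mod_minimalPeriod_eq.trans hi
  refine ⟨_, l, Equiv.ofBijective f hf, fun c => ?_, fun c i => ?_, fun c i => hpar _ _⟩
  · have h1 := hm0 (e.symm c)
    have h2 := hm2 (e.symm c)
    simp only [l]; omega
  · simp only [Equiv.ofBijective_apply, f]
    rw [val_finRotate, ← Function.iterate_succ_apply' (⇑π)]
    simp only [l, hm2]
    exact Function.iterate_mod_minimalPeriod_eq

end AlternatingCycles

/-! ### The gluing of a balanced decomposition -/

namespace EvenCycleDecomposition

variable {α β : Type*} {H : Graph α β} (C : EvenCycleDecomposition H)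

theorem isOddPos_next (p : C.Pos) : C.IsOddPos (C.next p) ↔ ¬ C.IsOddPos p := by
  have h : ((C.next p).2 : ℕ) = (p.2 + 1) % (2 * C.halfLength p.1) := val_finRotate p.2
  unfold IsOddPos
  rw [h, Nat.even_iff, Nat.mod_mod_of_dvd _ (dvd_mul_right _ _), ← Nat.even_iff, Nat.even_add_one]

theorem isEvenPos_iff (p : C.Pos) : C.IsEvenPos p ↔ ¬ C.IsOddPos p :=
  Nat.not_even_iff_odd.symm

theorem isLink_edgeAt (p : C.Pos) :
    H.IsLink (C.edgeAt p) (C.vertAt p) (C.vertAt (C.next p)) := C.isLink p.1 p.2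

/-- Positions correspond to edges of `H`. -/
noncomputable def edgeEquiv : C.Pos ≃ E(H) :=
  Equiv.ofBijective (fun p => ⟨C.edgeAt p, (C.isLink_edgeAt p).edge_mem⟩) <| by
    constructor
    · intro p q h
      have h : C.edgeAt p = C.edgeAt q := congrArg Subtype.val h
      exact (C.edge_unique _ (C.isLink_edgeAt q).edge_mem).unique h rfl
    · rintro ⟨e, he⟩
      obtain ⟨p, hp, -⟩ := C.edge_unique e he
      exact ⟨p, Subtype.ext hp⟩

theorem edgeAt_eq_iff (p q : C.Pos) : C.edgeAt p = C.edgeEquiv q ↔ p = q := by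
  rw [← C.edgeEquiv.injective.eq_iff]
  exact (Subtype.ext_iff (a1 := C.edgeEquiv p) (a2 := C.edgeEquiv q)).symm

open Classical in
/-- The end at an odd position of the edge traversed from `p` to the next position; that edge becomes
a degree `2` vertex of the diamond of this end. -/
noncomputable def tipAt (p : C.Pos) : α := if C.IsOddPos p then C.vertAt p else C.vertAt (C.next p)

open Classical in
/-- The end at an even position of the edge traversed from `p` to the next position; that edge becomes
a degree `3` vertex of the diamond of this end. -/
noncomputable def hubAt (p : C.Pos) : α := if C.IsOddPos p then C.vertAt (C.next p) else C.vertAt p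

theorem isLink_tipAt_hubAt (p : C.Pos) : H.IsLink (C.edgeAt p) (C.tipAt p) (C.hubAt p) := by
  unfold tipAt hubAt
  split_ifs
  · exact C.isLink_edgeAt p
  · exact (C.isLink_edgeAt p).symm

theorem pairAt_iff (x y : α) (p : C.Pos) : C.PairAt x y p ↔
    (C.tipAt p = x ∧ C.hubAt p = y) ∨ (C.tipAt p = y ∧ C.hubAt p = x) := by
  unfold PairAt AppearsAt tipAt hubAt
  split_ifs <;> tauto

variable {C}

theorem IsBalanced.existsUnique_odd (hb : C.IsBalanced) {x : α} (hx : x ∈ V(H)) :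
    ∃ o, C.IsOddPos o ∧ ∀ p, C.IsOddPos p → (C.vertAt p = x ↔ p = o) := by
  obtain ⟨o, ⟨h1, h2⟩, h3⟩ := (hb x hx).1
  exact ⟨o, h1, fun p hp => ⟨fun h => h3 p ⟨hp, h⟩, fun h => h ▸ h2⟩⟩

theorem IsBalanced.existsUnique_even (hb : C.IsBalanced) {x : α} (hx : x ∈ V(H)) :
    ∃ o, ¬ C.IsOddPos o ∧ ∀ p, ¬ C.IsOddPos p → (C.vertAt p = x ↔ p = o) := by
  obtain ⟨o, ⟨h1, h2⟩, h3⟩ := (hb x hx).2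
  rw [isEvenPos_iff] at h1
  exact ⟨o, h1, fun p hp => ⟨fun h => h3 p ⟨(C.isEvenPos_iff p).2 hp, h⟩, fun h => h ▸ h2⟩⟩

theorem IsBalanced.tipAt_eq_iff (hb : C.IsBalanced) {x : α} (hx : x ∈ V(H)) :
    ∃ o, C.IsOddPos o ∧ ∀ p, C.tipAt p = x ↔ p = o ∨ C.next p = o := by
  obtain ⟨o, h1, h2⟩ := hb.existsUnique_odd hx
  refine ⟨o, h1, fun p => ?_⟩
  have := C.isOddPos_next p
  unfold tipAt
  split_ifs with hp
  · have := h2 p hp; grind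
  · have := h2 (C.next p); grind

theorem IsBalanced.hubAt_eq_iff (hb : C.IsBalanced) {x : α} (hx : x ∈ V(H)) :
    ∃ o, ¬ C.IsOddPos o ∧ ∀ p, C.hubAt p = x ↔ p = o ∨ C.next p = o := by
  obtain ⟨o, h1, h2⟩ := hb.existsUnique_even hx
  refine ⟨o, h1, fun p => ?_⟩
  have := C.isOddPos_next p
  unfold hubAt
  split_ifs with hp
  · have := h2 (C.next p); grind
  · have := h2 p hp; grind

theorem next_ne (p : C.Pos) : C.next p ≠ p := by
  intro h
  have := C.isOddPos_next p
  rw [h] at this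
  tauto

theorem IsBalanced.consecutive_iff (hb : C.IsBalanced) (p q : C.Pos) :
    C.Consecutive p q ↔ p ≠ q ∧ (C.tipAt p = C.tipAt q ∨ C.hubAt p = C.hubAt q) := by
  obtain ⟨o, ho, ht⟩ := hb.tipAt_eq_iff (C.isLink_tipAt_hubAt q).left_mem
  obtain ⟨o', ho', hh⟩ := hb.hubAt_eq_iff (C.isLink_tipAt_hubAt q).right_mem
  rw [ht, hh]
  have h1 := (ht q).1 rfl
  have h2 := (hh q).1 rfl
  have h3 := C.next.injective.eq_iff (a := p) (b := q)
  have h4 := next_ne p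
  have h5 := next_ne q
  unfold Consecutive
  grind

theorem ncard_eq_two_of_forall_iff {f : C.Pos → α} {x : V(H)} {hf : ∀ p, f p ∈ V(H)}
    {o : C.Pos} (h : ∀ p, f p = x ↔ p = o ∨ C.next p = o) :
    ((fun p => (⟨f p, hf p⟩ : V(H))) ⁻¹' {x}).ncard = 2 := by
  rw [Set.ncard_eq_two]
  refine ⟨o, C.next.symm o, ?_, ?_⟩
  · intro ho
    exact next_ne (C.next.symm o) (by rw [Equiv.apply_symm_apply, ← ho])
  · ext p
    simp [Subtype.ext_iff, h, Equiv.eq_symm_apply]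

variable (C) in
/-- The gluing given by a balanced decomposition, with positions standing for edges of `H`. -/
noncomputable def toDiamondGluing (hl : H.Loopless) (hb : C.IsBalanced) :
    DiamondGluing C.Pos V(H) where
  tip p := ⟨C.tipAt p, (C.isLink_tipAt_hubAt p).left_mem⟩
  hub p := ⟨C.hubAt p, (C.isLink_tipAt_hubAt p).right_mem⟩
  tip_fiber x := by
    obtain ⟨o, -, h⟩ := hb.tipAt_eq_iff x.2
    exact ncard_eq_two_of_forall_iff h
  hub_fiber x := by
    obtain ⟨o, -, h⟩ := hb.hubAt_eq_iff x.2
    exact ncard_eq_two_of_forall_iff h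
  tip_ne_hub p h := (C.isLink_tipAt_hubAt p).ne (congrArg Subtype.val h)

theorem toDiamondGluing_tip (hl : H.Loopless) (hb : C.IsBalanced) (p : C.Pos) :
    (C.toDiamondGluing hl hb).tip p = ⟨C.tipAt p, (C.isLink_tipAt_hubAt p).left_mem⟩ := rfl

theorem toDiamondGluing_hub (hl : H.Loopless) (hb : C.IsBalanced) (p : C.Pos) :
    (C.toDiamondGluing hl hb).hub p = ⟨C.hubAt p, (C.isLink_tipAt_hubAt p).right_mem⟩ := rfl

theorem placed_false_iff (x : α) (p : C.Pos) :
    (∃ b, C.Placed x (false, b) (C.edgeEquiv p)) ↔ C.tipAt p = x := by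
  have := C.isOddPos_next p
  simp only [Bool.exists_bool, Placed, edgeAt_eq_iff, ← and_assoc, exists_eq_right]
  unfold tipAt
  split_ifs <;> tauto

theorem placed_true_iff (x : α) (p : C.Pos) :
    (∃ b, C.Placed x (true, b) (C.edgeEquiv p)) ↔ C.hubAt p = x := by
  have := C.isOddPos_next p
  simp only [Bool.exists_bool, Placed, edgeAt_eq_iff, ← and_assoc, exists_eq_right, isEvenPos_iff]
  unfold hubAt
  split_ifs <;> tauto

theorem IsBalanced.placed_unique (hb : C.IsBalanced) {x : α} (hx : x ∈ V(H)) {a : Bool × Bool}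
    {p q : C.Pos} (hp : C.Placed x a (C.edgeEquiv p)) (hq : C.Placed x a (C.edgeEquiv q)) :
    p = q := by
  obtain ⟨o, -, ho⟩ := hb.existsUnique_odd hx
  obtain ⟨o', -, ho'⟩ := hb.existsUnique_even hx
  obtain ⟨_ | _, _ | _⟩ := a <;>
    simp only [Placed, edgeAt_eq_iff, ← and_assoc, exists_eq_right, isEvenPos_iff] at hp hq
  · exact C.next.injective (((ho _ hp.1).1 hp.2).trans ((ho _ hq.1).1 hq.2).symm)
  · exact ((ho _ hp.1).1 hp.2).trans ((ho _ hq.1).1 hq.2).symm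
  · exact C.next.injective (((ho' _ hp.1).1 hp.2).trans ((ho' _ hq.1).1 hq.2).symm)
  · exact ((ho' _ hp.1).1 hp.2).trans ((ho' _ hq.1).1 hq.2).symm

theorem diamondReplacement_adj_iff (hl : H.Loopless) (hb : C.IsBalanced) (p q : C.Pos) :
    C.diamondReplacement.Adj (C.edgeEquiv p) (C.edgeEquiv q) ↔
      (C.toDiamondGluing hl hb).graph.Adj p q := by
  rw [DiamondGluing.graph_adj]
  simp only [toDiamondGluing_tip, toDiamondGluing_hub, Subtype.mk.injEq]
  change (C.edgeEquiv p ≠ C.edgeEquiv q ∧ _) ↔ _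
  rw [C.edgeEquiv.injective.ne_iff]
  refine and_congr_right fun hne => ?_
  have key : ∀ x ∈ V(H), ∀ a b, C.Placed x a (C.edgeEquiv p) → C.Placed x b (C.edgeEquiv q) →
      a ≠ b := by
    rintro x hx a _ ha hb' rfl
    exact hne (hb.placed_unique hx ha hb')
  constructor
  · rintro ⟨x, hx, ⟨a, a'⟩, ⟨b, b'⟩, hab, ha, hb'⟩
    cases a <;> cases b <;>
      first
      | have h1 := (placed_false_iff x p).1 ⟨_, ha⟩
      | have h1 := (placed_true_iff x p).1 ⟨_, ha⟩
    all_goals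
      first
      | have h2 := (placed_false_iff x q).1 ⟨_, hb'⟩
      | have h2 := (placed_true_iff x q).1 ⟨_, hb'⟩
    · simp [diamond] at hab
    · exact .inr (.inr (h1.trans h2.symm))
    · exact .inr (.inl (h1.trans h2.symm))
    · exact .inl (h1.trans h2.symm)
  · rintro (h | h | h)
    · obtain ⟨a, ha⟩ := (placed_true_iff _ p).2 rfl
      obtain ⟨b, hb'⟩ := (placed_true_iff _ q).2 h.symm
      have hx := (C.isLink_tipAt_hubAt p).right_mem
      exact ⟨_, hx, _, _, ⟨key _ hx _ _ ha hb', .inl rfl⟩, ha, hb'⟩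
    · obtain ⟨a, ha⟩ := (placed_true_iff _ p).2 rfl
      obtain ⟨b, hb'⟩ := (placed_false_iff _ q).2 h.symm
      have hx := (C.isLink_tipAt_hubAt p).right_mem
      exact ⟨_, hx, _, _, ⟨key _ hx _ _ ha hb', .inl rfl⟩, ha, hb'⟩
    · obtain ⟨a, ha⟩ := (placed_false_iff _ p).2 rfl
      obtain ⟨b, hb'⟩ := (placed_true_iff _ q).2 h.symm
      have hx := (C.isLink_tipAt_hubAt p).left_mem
      exact ⟨_, hx, _, _, ⟨key _ hx _ _ ha hb', .inr rfl⟩, ha, hb'⟩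

variable (C) in
/-- The diamond replacement is the glued graph. -/
noncomputable def graphIso (hl : H.Loopless) (hb : C.IsBalanced) :
    (C.toDiamondGluing hl hb).graph ≃g C.diamondReplacement where
  toEquiv := C.edgeEquiv
  map_rel_iff' := diamondReplacement_adj_iff hl hb _ _

theorem pairsUnique_toDiamondGluing_iff (hl : H.Loopless) (hb : C.IsBalanced) :
    (C.toDiamondGluing hl hb).PairsUnique ↔ C.PairsUnique := by
  unfold DiamondGluing.PairsUnique PairsUnique Set.Subsingleton
  simp only [toDiamondGluing_tip, toDiamondGluing_hub, Subtype.mk.injEq, Set.mem_ofPred_eq,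
    pairAt_iff]
  constructor
  · intro h x y p hp q hq
    apply h
    grind
  · intro h p q hpq
    exact h (C.tipAt p) (C.hubAt p) (.inl ⟨rfl, rfl⟩) (by grind)

/-- Each pair at a position runs from a tip to a hub. Pairs that share a vertex of `H` without being
consecutive have it once as a tip and once as a hub, so three of them form a cyclic triple. -/
theorem noCyclicTriple_toDiamondGluing_iff (hl : H.Loopless) (hb : C.IsBalanced) :
    (C.toDiamondGluing hl hb).NoCyclicTriple ↔ C.NoSpreadTriangle := by
  unfold DiamondGluing.NoCyclicTriple NoSpreadTriangle
  simp only [toDiamondGluing_tip, toDiamondGluing_hub, Subtype.mk.injEq,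
    pairAt_iff, hb.consecutive_iff]
  have hne : ∀ p, C.tipAt p ≠ C.hubAt p := fun p => (C.isLink_tipAt_hubAt p).ne
  constructor
  · intro h x y z p q r hp hq hr
    have := h p q r
    have := h p r q
    have := hne p
    have := hne q
    have := hne r
    grind
  · intro h p q r h1 h2 h3
    have := h (C.tipAt p) (C.tipAt q) (C.tipAt r) p q r (.inl ⟨rfl, h1⟩) (.inl ⟨rfl, h2⟩)
      (.inl ⟨rfl, h3⟩)
    have := hne p
    have := hne q
    have := hne r
    grind

theorem isOptimalQuintic_diamondReplacement_iff {n : ℕ} (hH : IsQuartic H n) (hb : C.IsBalanced) :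
    IsOptimalQuintic C.diamondReplacement n ↔ C.PairsUnique ∧ C.NoSpreadTriangle := by
  have hl := hH.loopless
  have : Finite V(H) := by
    apply Set.finite_of_encard_eq_coe hH.card_eq
  have hV : Nat.card V(H) = n := by
    rw [Nat.card_coe_set_eq, Set.ncard_def, hH.card_eq, ENat.toNat_natCast]
  have hP : Nat.card C.Pos = 2 * n := by
    rw [card_eq_two_mul_of_two_fibers (C.toDiamondGluing hl hb).tip_fiber, hV]
  rw [← pairsUnique_toDiamondGluing_iff hl hb, ← noCyclicTriple_toDiamondGluing_iff hl hb,
    ← DiamondGluing.isOptimalQuintic_graph_iff hP]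
  exact ⟨fun h => h.of_iso (C.graphIso hl hb).symm, fun h => h.of_iso (C.graphIso hl hb)⟩

end EvenCycleDecomposition

/-- A two-to-one map gives the involution that exchanges the two elements of each fiber. -/
theorem exists_fiber_involution {P Q : Type*} {f : P → Q} (h : ∀ x, (f ⁻¹' {x}).ncard = 2) :
    ∃ σ : P → P, Function.Involutive σ ∧ (∀ p, σ p ≠ p) ∧
      ∀ p q, f p = f q ↔ p = q ∨ p = σ q := by
  have hex : ∀ p, ∃ q, q ≠ p ∧ ∀ r, f r = f p ↔ r = p ∨ r = q := by
    intro p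
    obtain ⟨u, v, huv, h⟩ := two_fiber_iff (h (f p))
    obtain rfl | rfl := (h p).1 rfl
    · exact ⟨v, huv.symm, h⟩
    · exact ⟨u, huv, fun r => by rw [h, or_comm]⟩
  choose σ h1 h2 using hex
  refine ⟨σ, fun p => ?_, h1, fun p q => h2 q p⟩
  have h3 := (h2 p (σ p)).2 (.inr rfl)
  exact (((h2 (σ p) p).1 h3.symm).resolve_left (h1 p).symm).symm

/-! ### Realizing a gluing by a decomposition -/

namespace DiamondGluing

variable {P Q : Type*} (D : DiamondGluing P Q)

/-- The multigraph whose vertices are the diamonds and whose edge `p` joins `tip p` to `hub p`. -/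
def multigraph : Graph Q P where
  vertexSet := Set.univ
  IsLink e x y := (x = D.tip e ∧ y = D.hub e) ∨ (x = D.hub e ∧ y = D.tip e)
  isLink_symm e _ := ⟨fun x y h => by tauto⟩
  eq_or_eq_of_isLink_of_isLink e x y v w h h' := by grind
  left_mem_of_isLink _ _ _ _ := Set.mem_univ _

theorem multigraph_isLink (e : P) (x y : Q) : D.multigraph.IsLink e x y ↔
    (x = D.tip e ∧ y = D.hub e) ∨ (x = D.hub e ∧ y = D.tip e) := Iff.rfl

theorem isQuartic_multigraph [Finite P] {n : ℕ} [Finite Q] (hQ : Nat.card Q = n) :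
    IsQuartic D.multigraph n where
  loopless := ⟨fun e x h => by
    have := D.tip_ne_hub e
    rw [← Graph.isLink_self_iff, multigraph_isLink] at h
    grind⟩
  card_eq := by
    change (Set.univ : Set Q).encard = n
    rw [Set.encard_univ, ← hQ, ENat.card_eq_coe_natCard]
  regular x _ := by
    have e : D.multigraph.incidenceSet x = D.tip ⁻¹' {x} ∪ D.hub ⁻¹' {x} := by
      ext e
      change (∃ y, D.multigraph.IsLink e x y) ↔ _
      simp only [multigraph_isLink, Set.mem_union, Set.mem_preimage, Set.mem_singleton_iff]
      grind
    rw [e, Set.ncard_union_eq, D.tip_fiber, D.hub_fiber]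
    rw [Set.disjoint_left]
    intro p h1 h2
    exact D.tip_ne_hub p (h1.trans h2.symm)

theorem exists_decomposition [Finite P] : ∃ C : EvenCycleDecomposition D.multigraph,
    C.IsBalanced ∧ ∃ f : C.Pos ≃ P,
      (∀ p, C.tipAt p = D.tip (f p)) ∧ ∀ p, C.hubAt p = D.hub (f p) := by
  classical
  obtain ⟨τ, hτ, hτ', hτf⟩ := exists_fiber_involution D.tip_fiber
  obtain ⟨σ, hσ, hσ', hσf⟩ := exists_fiber_involution D.hub_fiber
  obtain ⟨A, hAσ, hAτ⟩ := exists_set_alternating hσ hτ hσ' hτ'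
  -- Edges in `A` are traversed from tip to hub and the others from hub to tip; `π` leads to the next
  -- edge of the cycle, which meets the present one in the same diamond and in the same role.
  let π : Equiv.Perm P :=
    { toFun := fun p => if p ∈ A then σ p else τ p
      invFun := fun p => if p ∈ A then τ p else σ p
      left_inv := fun p => by
        have := hσ p
        have := hτ p
        grind
      right_inv := fun p => by
        have := hσ p
        have := hτ p
        grind }
  have hπ : ∀ p, π p = if p ∈ A then σ p else τ p := fun p => rfl
  have hπA : ∀ p, π p ∈ A ↔ p ∉ A := by
    intro p
    rw [hπ]
    split_ifs
    exacts [hAσ p, hAτ p]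
  obtain ⟨N, l, f, hl, hf, hfA⟩ := exists_cycles_of_alternating π A hπA
  have hτtip : ∀ p, D.tip (τ p) = D.tip p := fun p => (hτf _ _).2 (.inr rfl)
  have hσhub : ∀ p, D.hub (σ p) = D.hub p := fun p => (hσf _ _).2 (.inr rfl)
  let vert : P → Q := fun p => if p ∈ A then D.tip p else D.hub p
  have hvert : ∀ p, vert (π p) = if p ∈ A then D.hub p else D.tip p := by
    intro p
    have h := hπA p
    simp only [vert]
    by_cases hp : p ∈ A
    · rw [if_neg (by tauto), if_pos hp, hπ, if_pos hp, hσhub]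
    · rw [if_pos (by tauto), if_neg hp, hπ, if_neg hp, hτtip]
  let C : EvenCycleDecomposition D.multigraph :=
    { numCycles := N
      halfLength := l
      halfLength_pos := hl
      vert := fun c i => vert (f ⟨c, i⟩)
      edge := fun c i => f ⟨c, i⟩
      isLink := fun c i => by
        rw [hf, hvert, multigraph_isLink]
        simp only [vert]
        split_ifs <;> simp
      edge_unique := fun e _ => f.bijective.existsUnique e }
  have hodd : ∀ p : C.Pos, C.IsOddPos p ↔ f p ∈ A := fun p => (hfA p.1 p.2).symm
  have hvertAt : ∀ p : C.Pos, C.vertAt p = vert (f p) := fun p => rfl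
  have hnext : ∀ p : C.Pos, C.vertAt (C.next p) = vert (π (f p)) := fun p =>
    congrArg vert (hf p.1 p.2)
  refine ⟨C, fun x _ => ⟨?_, ?_⟩, f, fun p => ?_, fun p => ?_⟩
  · obtain ⟨e, heA, he⟩ : ∃ e ∈ A, D.tip e = x := by
      obtain ⟨e, _, -, he⟩ := two_fiber_iff (D.tip_fiber x)
      have he := (he e).2 (.inl rfl)
      by_cases heA : e ∈ A
      · exact ⟨e, heA, he⟩
      · exact ⟨τ e, (hAτ e).2 heA, (hτtip e).trans he⟩
    refine ⟨f.symm e, ?_, ?_⟩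
    · simp only [hodd, hvertAt, vert, Equiv.apply_symm_apply, if_pos heA]
      exact ⟨heA, he⟩
    · rintro p ⟨hp, hpx⟩
      rw [hodd] at hp
      simp only [hvertAt, vert, if_pos hp] at hpx
      rw [Equiv.eq_symm_apply]
      refine ((hτf _ _).1 (hpx.trans he.symm)).resolve_right fun h => ?_
      exact (hAτ e).1 (h ▸ hp) heA
  · obtain ⟨e, heA, he⟩ : ∃ e, e ∉ A ∧ D.hub e = x := by
      obtain ⟨e, _, -, he⟩ := two_fiber_iff (D.hub_fiber x)
      have he := (he e).2 (.inl rfl)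
      by_cases heA : e ∈ A
      · exact ⟨σ e, fun h => (hAσ e).1 h heA, (hσhub e).trans he⟩
      · exact ⟨e, heA, he⟩
    refine ⟨f.symm e, ?_, ?_⟩
    · simp only [C.isEvenPos_iff, hodd, hvertAt, vert, Equiv.apply_symm_apply, if_neg heA]
      exact ⟨heA, he⟩
    · rintro p ⟨hp, hpx⟩
      rw [C.isEvenPos_iff, hodd] at hp
      simp only [hvertAt, vert, if_neg hp] at hpx
      rw [Equiv.eq_symm_apply]
      refine ((hσf _ _).1 (hpx.trans he.symm)).resolve_right fun h => hp ?_
      rw [h]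
      exact (hAσ e).2 heA
  · simp only [EvenCycleDecomposition.tipAt, hodd, hnext, hvert]
    simp only [hvertAt, vert]
    split_ifs <;> rfl
  · simp only [EvenCycleDecomposition.hubAt, hodd, hnext, hvert]
    simp only [hvertAt, vert]
    split_ifs <;> rfl

/-- A gluing with its vertices relabeled. -/
def comap {P' : Type*} (e : P' ≃ P) : DiamondGluing P' Q where
  tip p := D.tip (e p)
  hub p := D.hub (e p)
  tip_fiber x := by
    rw [← D.tip_fiber x, ← Set.ncard_preimage_of_injective_subset_range e.injective (by simp)]
    rfl
  hub_fiber x := by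
    rw [← D.hub_fiber x, ← Set.ncard_preimage_of_injective_subset_range e.injective (by simp)]
    rfl
  tip_ne_hub p := D.tip_ne_hub (e p)

theorem exists_graph_iso_diamondReplacement [Finite P] [Finite Q] {n : ℕ} (hQ : Nat.card Q = n) :
    ∃ C : EvenCycleDecomposition D.multigraph,
      C.IsBalanced ∧ Nonempty (D.graph ≃g C.diamondReplacement) := by
  obtain ⟨C, hb, f, htip, hhub⟩ := D.exists_decomposition
  have hl := (D.isQuartic_multigraph hQ).loopless
  refine ⟨C, hb, ⟨(C.graphIso hl hb).comp ⟨f.symm, ?_⟩⟩⟩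
  intro p q
  simp only [graph_adj, EvenCycleDecomposition.toDiamondGluing_tip,
    EvenCycleDecomposition.toDiamondGluing_hub, Subtype.mk.injEq, htip, hhub,
    Equiv.apply_symm_apply, ne_eq, f.symm.injective.eq_iff]

end DiamondGluing

theorem lemma2 (n : ℕ) :
    (∀ {W : Type*} (G : SimpleGraph W), IsOptimalQuintic G n →
      ∃ (H : Graph (Fin n) (Fin (2 * n))) (C : EvenCycleDecomposition H),
        IsQuartic H n ∧ C.IsBalanced ∧ C.PairsUnique ∧ C.NoSpreadTriangle ∧
          Nonempty (G ≃g C.diamondReplacement)) ∧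
    (∀ {α β : Type*} (H : Graph α β) (C : EvenCycleDecomposition H),
      IsQuartic H n → C.IsBalanced →
        (IsOptimalQuintic C.diamondReplacement n ↔ C.PairsUnique ∧ C.NoSpreadTriangle)) := by
  refine ⟨fun {W} G hG => ?_, fun H C hH hb => C.isOptimalQuintic_diamondReplacement_iff hH hb⟩
  obtain ⟨D, rfl⟩ := hG.exists_diamondGluing
  have := hG.finite
  let e : Fin (2 * n) ≃ W := ((Finite.equivFin W).trans (finCongr hG.card_eq)).symm
  have hQ : Nat.card (Fin n) = n := by simp
  obtain ⟨C, hb, ⟨φ⟩⟩ := (D.comap e).exists_graph_iso_diamondReplacement hQ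
  have hH := (D.comap e).isQuartic_multigraph hQ
  have ψ : D.graph ≃g C.diamondReplacement := φ.comp
    (SimpleGraph.Iso.symm ⟨e, by
      simp [DiamondGluing.graph_adj, DiamondGluing.comap]⟩)
  obtain ⟨h1, h2⟩ := (C.isOptimalQuintic_diamondReplacement_iff hH hb).1 (hG.of_iso ψ)
  exact ⟨_, C, hH, hb, h1, h2, ⟨ψ⟩⟩
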